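/- Let $D\ge 4$ and let $W$ be an open set of values of the coordinates $(u,x)=(u,x^1,\dots,x^{D-2})$. Let $\gamma_{ij}(x)$ be a smooth Riemannian metric with $\det\gamma=1$, let $P(u,x)>0$ and $\mu(u)$ be smooth, and let $\Lambda\in\mathbb R$. Put $h_{ij}=P^{-2}\gamma_{ij}$ (for each fixed $u$ a metric in the variables $x$), let $\mathcal R_{ij}$ and $\mathcal R$ be the Ricci tensor and the Ricci scalar of $h$, and assume $\mathcal R_{ij}=\frac{\mathcal R}{D-2}h_{ij}$ on $W$. The $D$-dimensional Robinson–Trautman metric with cosmological constant $\Lambda$ is, for $(u,x)\in W$ and $r>0$, $$ds^2=r^2h_{ij}\,dx^i dx^j-2\,du\,dr-2H\,du^2,\qquad 2H=\frac{\mathcal R}{(D-2)(D-3)}-2r(\ln P)_{,u}-\frac{2\Lambda}{(D-2)(D-1)}r^2-\frac{\mu(u)}{r^{D-3}}.$$ Let $R(u,x)>0$ be a $C^2$ function on $W$ and let $l=\partial_r$. An ingoing null congruence of the hypersurface $r=R(u,x)$ is a vector field $n$, differentiable at the points of the hypersurface, that at these points is null, is orthogonal to the sections $u=\mathrm{const}$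 of the hypersurface, and satisfies $g(l,n)=-1$. For null fields $l,n$ with $g(l,n)=-1$ put $p^{ab}=g^{ab}+2l^{(a}n^{b)}$, where $2l^{(a}n^{b)}=l^an^b+l^bn^a$, and define the expansions $\Theta_n=n_{a;b}\,p^{ab}$ and $\Theta_l=l_{a;b}\,p^{ab}$. Then: 1. The field $n=\bigl(1,\,-H+\tfrac12 g^{ij}R_{,i}R_{,j},\,g^{ij}R_{,j}\bigr)$, in the coordinates $(u,r,x^i)$ and with $g^{ij}=r^{-2}h^{ij}$, is an ingoing null congruence of the hypersurface $r=R(u,x)$. 2. For every ingoing null congruence $n$ of the hypersurface and every $(u,x)\in W$, the expansion $\Theta_n$ vanishes at the point $(u,R(u,x),x)$ if and only if at $(u,x)$ $$\mathcal R-\frac{2(D-3)}{D-1}\Lambda R^2-(D-2)(D-3)\frac{\mu}{R^{D-3}}-2(D-3)\,\Delta\ln R-(D-4)(D-3)\,\nabla\ln R\cdot\nabla\ln R=0,$$ where the Laplacian $\Delta$, the gradient $\nabla$ and the scalar product are those of the metric $h$ at fixed $u$. In particular, $\Theta_n$ vanishes on the whole hypersurface if and only if $R$ satisfies this equation on $W$.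 3. The expansion of the outgoing congruence is $\Theta_l=\frac{D-2}{r}$ at every point with $(u,x)\in W$ and $r>0$, whichever null vector $n$ with $g(l,n)=-1$ is used in $p^{ab}$. -/

import Mathlib

open scoped ContDiff

namespace RobinsonTrautman

/-! Tensor calculus of a (pseudo-)Riemannian metric in a coordinate patch. Coordinates are indexed by
a finite type `ι`, and a metric is given by its matrix of components. -/

section Coordinates

variable {ι : Type} [Fintype ι] [DecidableEq ι]

/-- The coordinate partial derivative `∂ₖ f` at `p`. -/
noncomputable def pd (k : ι) (f : (ι → ℝ) → ℝ) (p : ι → ℝ) : ℝ :=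
  fderiv ℝ f p (Pi.single k 1)

/-- The scalar product `g(v, w)` of two vectors at `p`. -/
def ip (g : (ι → ℝ) → Matrix ι ι ℝ) (p : ι → ℝ) (v w : ι → ℝ) : ℝ :=
  ∑ a, ∑ b, g p a b * v a * w b

/-- Lowering the index of a vector field, `v_a = g_{ab} v^b`. -/
def lower (g : (ι → ℝ) → Matrix ι ι ℝ) (v : (ι → ℝ) → ι → ℝ) : (ι → ℝ) → ι → ℝ :=
  fun p a => ∑ b, g p a b * v p b

/-- The Christoffel symbol `Γ^c_{ab}` of the Levi-Civita connection of `g`. -/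
noncomputable def christoffel (g : (ι → ℝ) → Matrix ι ι ℝ) (c a b : ι) (p : ι → ℝ) : ℝ :=
  (1 / 2) * ∑ d, (g p)⁻¹ c d *
    (pd a (fun q => g q d b) p + pd b (fun q => g q d a) p - pd d (fun q => g q a b) p)

/-- The covariant derivative `k_{a;b} = ∂_b k_a - Γ^c_{ab} k_c` of a covector field. -/
noncomputable def covDeriv (g : (ι → ℝ) → Matrix ι ι ℝ) (k : (ι → ℝ) → ι → ℝ) (a b : ι)
    (p : ι → ℝ) : ℝ :=
  pd b (fun q => k q a) p - ∑ c, christoffel g c a b p * k p c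

/-- The Ricci tensor
`∂_c Γ^c_{ab} - ∂_b Γ^c_{ac} + Γ^c_{cd} Γ^d_{ab} - Γ^c_{bd} Γ^d_{ac}`
(positive on round spheres). -/
noncomputable def ricci (g : (ι → ℝ) → Matrix ι ι ℝ) (a b : ι) (p : ι → ℝ) : ℝ :=
  ∑ c, (pd c (christoffel g c a b) p - pd b (christoffel g c a c) p) +
    ∑ c, ∑ d, (christoffel g c c d p * christoffel g d a b p -
      christoffel g c b d p * christoffel g d a c p)

/-- The Ricci scalar `g^{ab} R_{ab}`. -/
noncomputable def scalarCurvature (g : (ι → ℝ) → Matrix ι ι ℝ) (p : ι → ℝ) : ℝ :=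
  ∑ a, ∑ b, (g p)⁻¹ a b * ricci g a b p

/-- The gradient `∇^a f = g^{ab} ∂_b f`. -/
noncomputable def gradient (g : (ι → ℝ) → Matrix ι ι ℝ) (f : (ι → ℝ) → ℝ) (p : ι → ℝ) : ι → ℝ :=
  fun a => ∑ b, (g p)⁻¹ a b * pd b f p

/-- The Laplace–Beltrami operator `Δ f = g^{ab} f_{;ab}`. -/
noncomputable def laplacian (g : (ι → ℝ) → Matrix ι ι ℝ) (f : (ι → ℝ) → ℝ) (p : ι → ℝ) : ℝ :=
  ∑ a, ∑ b, (g p)⁻¹ a b * covDeriv g (fun q c => pd c f q) a b p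

/-- The projector `p^{ab} = g^{ab} + 2 l^{(a} n^{b)}` determined by two null vectors with
`g(l, n) = -1`. -/
noncomputable def projector (g : (ι → ℝ) → Matrix ι ι ℝ) (p : ι → ℝ) (l n : ι → ℝ) (a b : ι) : ℝ :=
  (g p)⁻¹ a b + (l a * n b + l b * n a)

/-- The expansion `Θ_k = k_{a;b} p^{ab}` of the congruence generated by the vector field `k`, with
respect to the projector of the null pair `l, n`. -/
noncomputable def expansion (g : (ι → ℝ) → Matrix ι ι ℝ) (l n k : (ι → ℝ) → ι → ℝ)
    (p : ι → ℝ) : ℝ :=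
  ∑ a, ∑ b, covDeriv g (lower g k) a b p * projector g p (l p) (n p) a b

end Coordinates

/-- The transverse metric `h_{ij} = P⁻² γ_{ij}` at retarded time `u`. -/
noncomputable def transverseMetric {m : ℕ} (γ : (Fin m → ℝ) → Matrix (Fin m) (Fin m) ℝ)
    (P : ℝ → (Fin m → ℝ) → ℝ) (u : ℝ) : (Fin m → ℝ) → Matrix (Fin m) (Fin m) ℝ :=
  fun x => ((P u x) ^ 2)⁻¹ • γ x

/-- The data of a `D`-dimensional Robinson–Trautman metric over a coordinate patch `W` of the
variables `(u, x)`: the cosmological constant `Λ`, the mass function `μ(u)`, the unimodular spatial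
metric `γ(x)` and the function `P(u, x)`, such that `h = P⁻² γ` satisfies
`Ric(h) = (𝓡 / (D - 2)) h`. -/
structure Data (D : ℕ) where
  W : Set (ℝ × (Fin (D - 2) → ℝ))
  isOpen_W : IsOpen W
  Λ : ℝ
  μ : ℝ → ℝ
  μ_smooth : ContDiffOn ℝ ∞ μ (Prod.fst '' W)
  γ : (Fin (D - 2) → ℝ) → Matrix (Fin (D - 2)) (Fin (D - 2)) ℝ
  γ_smooth : ∀ i j, ContDiffOn ℝ ∞ (fun x => γ x i j) (Prod.snd '' W)
  γ_posDef : ∀ x ∈ Prod.snd '' W, (γ x).PosDef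
  γ_unimodular : ∀ x ∈ Prod.snd '' W, (γ x).det = 1
  P : ℝ → (Fin (D - 2) → ℝ) → ℝ
  P_smooth : ContDiffOn ℝ ∞ (fun q : ℝ × (Fin (D - 2) → ℝ) => P q.1 q.2) W
  P_pos : ∀ q ∈ W, 0 < P q.1 q.2
  einstein : ∀ q ∈ W, ∀ i j, ricci (transverseMetric γ P q.1) i j q.2 =
    scalarCurvature (transverseMetric γ P q.1) q.2 / ((D : ℝ) - 2) *
      transverseMetric γ P q.1 q.2 i j

/-- Indices of the spacetime coordinates `(u, r, x)`: `u` is `Sum.inl 0`, `r` is `Sum.inl 1` and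
`x^i` is `Sum.inr i`. -/
abbrev Idx (D : ℕ) : Type := Fin 2 ⊕ Fin (D - 2)

/-- The spacetime point with coordinates `(u, r, x)`; also the vector with these components. -/
def mk {D : ℕ} (u r : ℝ) (x : Fin (D - 2) → ℝ) : Idx D → ℝ := Sum.elim ![u, r] x

namespace Data

variable {D : ℕ} (S : Data D)

/-- The Einstein metric `h` at retarded time `u`. -/
noncomputable def h (u : ℝ) : (Fin (D - 2) → ℝ) → Matrix (Fin (D - 2)) (Fin (D - 2)) ℝ :=
  transverseMetric S.γ S.P u

/-- The function `H`, where
`2H = 𝓡 / ((D-2)(D-3)) - 2 r (ln P)_{,u} - 2 Λ r² / ((D-2)(D-1)) - μ(u) / r^{D-3}`. -/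
noncomputable def H (u r : ℝ) (x : Fin (D - 2) → ℝ) : ℝ :=
  (1 / 2) * (scalarCurvature (S.h u) x / (((D : ℝ) - 2) * ((D : ℝ) - 3))
    - 2 * r * deriv (fun s => Real.log (S.P s x)) u
    - 2 * S.Λ / (((D : ℝ) - 2) * ((D : ℝ) - 1)) * r ^ 2
    - S.μ u / r ^ (D - 3))

/-- The spacetime metric `r² h_{ij} dx^i dx^j - 2 du dr - 2H du²`. -/
noncomputable def metric : (Idx D → ℝ) → Matrix (Idx D) (Idx D) ℝ := fun p =>
  Matrix.fromBlocks
    !![-2 * S.H (p (Sum.inl 0)) (p (Sum.inl 1)) (fun i => p (Sum.inr i)), -1; -1, 0] 0 0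
    ((p (Sum.inl 1)) ^ 2 • S.h (p (Sum.inl 0)) (fun i => p (Sum.inr i)))

end Data

/-- The outgoing null vector field `l = ∂_r`. -/
def outgoing {D : ℕ} : (Idx D → ℝ) → Idx D → ℝ := fun _ => mk 0 1 0

/-- The tangent vector `∂/∂x^i` of the section `x ↦ (u, R(u, x), x)`, at the point over `(u, x)`. -/
noncomputable def sectionTangent {D : ℕ} (R : ℝ → (Fin (D - 2) → ℝ) → ℝ) (u : ℝ)
    (x : Fin (D - 2) → ℝ) (i : Fin (D - 2)) : Idx D → ℝ :=
  fun a => pd i (fun y => mk u (R u y) y a) x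

/-- `n` is the ingoing null congruence of the hypersurface `r = R(u, x)`: it is differentiable at
every point of the hypersurface, and there it is null, orthogonal to the section `u = const` of the
hypersurface, and normalized by `g(l, n) = -1`. (As `l` is null and also orthogonal to the sections,
these conditions determine `n` on the hypersurface.) -/
structure IsIngoing {D : ℕ} (S : Data D) (R : ℝ → (Fin (D - 2) → ℝ) → ℝ)
    (n : (Idx D → ℝ) → Idx D → ℝ) : Prop where
  differentiable : ∀ u x, (u, x) ∈ S.W → DifferentiableAt ℝ n (mk u (R u x) x)
  null : ∀ u x, (u, x) ∈ S.W →
    ip S.metric (mk u (R u x) x) (n (mk u (R u x) x)) (n (mk u (R u x) x)) = 0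
  normalized : ∀ u x, (u, x) ∈ S.W →
    ip S.metric (mk u (R u x) x) (outgoing (mk u (R u x) x)) (n (mk u (R u x) x)) = -1
  orthogonal : ∀ u x, (u, x) ∈ S.W → ∀ i,
    ip S.metric (mk u (R u x) x) (n (mk u (R u x) x)) (sectionTangent R u x i) = 0

/-- The explicit field `n = (1, -H + ½ g^{ij} R_{,i} R_{,j}, g^{ij} R_{,j})`, where
`g^{ij} = r⁻² h^{ij}`. -/
noncomputable def ingoing {D : ℕ} (S : Data D) (R : ℝ → (Fin (D - 2) → ℝ) → ℝ) :
    (Idx D → ℝ) → Idx D → ℝ := fun p =>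
  let u := p (Sum.inl 0)
  let r := p (Sum.inl 1)
  let x : Fin (D - 2) → ℝ := fun i => p (Sum.inr i)
  mk 1
    (-S.H u r x + (1 / 2) * ((r ^ 2)⁻¹ *
      ip (S.h u) x (gradient (S.h u) (R u) x) (gradient (S.h u) (R u) x)))
    ((r ^ 2)⁻¹ • gradient (S.h u) (R u) x)

/-- The left-hand side of the generalized Penrose–Tod equation at `(u, x)`. -/
noncomputable def penroseTod {D : ℕ} (S : Data D) (R : ℝ → (Fin (D - 2) → ℝ) → ℝ) (u : ℝ)
    (x : Fin (D - 2) → ℝ) : ℝ :=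
  scalarCurvature (S.h u) x
    - 2 * ((D : ℝ) - 3) / ((D : ℝ) - 1) * S.Λ * (R u x) ^ 2
    - ((D : ℝ) - 2) * ((D : ℝ) - 3) * (S.μ u / (R u x) ^ (D - 3))
    - 2 * ((D : ℝ) - 3) * laplacian (S.h u) (fun y => Real.log (R u y)) x
    - ((D : ℝ) - 4) * ((D : ℝ) - 3) *
      ip (S.h u) x (gradient (S.h u) (fun y => Real.log (R u y)) x)
        (gradient (S.h u) (fun y => Real.log (R u y)) x)

end RobinsonTrautman

namespace RobinsonTrautman

/-! On the hypersurface the conditions on `n` fix all its components: normalization gives `n^u = 1`,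
orthogonality gives `n^i = R⁻² h^{ij} R_{,j}`, and nullity then gives `n^r = -H + ½ R⁻² |∇R|²`.
Lowered, this reads `n_r = -1` and `n_i = R_{,i}`.

The projector has no component along `du` (`sum_mul_projector`), so only `∇n` with indices `r` and
`x^i` matters, and there no derivative of `H` occurs. Off the hypersurface `n` is arbitrary: only
derivatives along the tangent directions `∂_j + R_{,j} ∂_r` are known. The unknown transverse
derivatives `∂_r n_r` and `∂_r n_i` cancel in the trace, leaving (`expansion_ingoing`) `Θ_n = R⁻² ΔR
- 2 R⁻³ |∇R|² - (D-2) (ln P)_{,u} + (D-2) R⁻¹ n^r`. Inserting `n^r` and `H` cancels `(ln P)_{,u}`,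
and rewriting `ΔR` and `∇R` through `ln R` identifies the equation's left side with `-2 R (D-3)
Θ_n`, a nonzero multiple of the expansion (`expansion_eq_zero_iff`).

For `l`, the lowered field is `-du`, whose covariant derivative has spatial part `r h_{ij}`; tracing
with `r⁻² h^{ij}` gives `(D-2)/r`. -/

lemma ip_smul_smul {ι : Type} [Fintype ι] {p : ι → ℝ} (g : (ι → ℝ) → Matrix ι ι ℝ) (c d : ℝ) (v w : ι → ℝ) :
    ip g p (c • v) (d • w) = c * d * ip g p v w := by
  simp only [ip, Pi.smul_apply, smul_eq_mul, Finset.mul_sum]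
  exact Finset.sum_congr rfl fun a _ => Finset.sum_congr rfl fun b _ => by ring

/-! ### Coordinate tensor calculus -/

section Coordinates

variable {ι : Type} [DecidableEq ι]

@[simp] lemma pd_const (k : ι) (c : ℝ) (p : ι → ℝ) : pd k (fun _ => c) p = 0 := by
  simp [pd]

lemma pd_congr {k : ι} {f g : (ι → ℝ) → ℝ} {p : ι → ℝ} (h : f =ᶠ[nhds p] g) :
    pd k f p = pd k g p := by
  rw [pd, pd, h.fderiv_eq]

lemma pd_coord (k j : ι) (p : ι → ℝ) :
    pd k (fun y => y j) p = if j = k then 1 else 0 := by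
  have h : HasFDerivAt (fun y : ι → ℝ => y j)
      (ContinuousLinearMap.proj (R := ℝ) (φ := fun _ : ι => ℝ) j) p :=
    (ContinuousLinearMap.proj (R := ℝ) (φ := fun _ : ι => ℝ) j).hasFDerivAt
  rw [pd, h.fderiv]
  simp [Pi.single_apply]

variable [Fintype ι]

lemma fderiv_apply_eq_sum (f : (ι → ℝ) → ℝ) (p v : ι → ℝ) :
    fderiv ℝ f p v = ∑ a, v a * pd a f p := by
  conv_lhs => rw [pi_eq_sum_univ' v]
  simp only [map_sum, map_smul, smul_eq_mul, pd]

/-- Metric compatibility turns the covariant derivative of a covector `k = g(v, ·)` into an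
expression without the inverse metric. -/
lemma covDeriv_eq {g : (ι → ℝ) → Matrix ι ι ℝ} {k : (ι → ℝ) → ι → ℝ} {p v : ι → ℝ}
    (hs : (g p).IsSymm) (hdet : IsUnit (g p).det) (hk : ∀ c, k p c = ∑ b, g p c b * v b)
    (a b : ι) :
    covDeriv g k a b p = pd b (fun q => k q a) p - (1 / 2) * ∑ d, v d *
      (pd a (fun q => g q d b) p + pd b (fun q => g q d a) p - pd d (fun q => g q a b) p) := by
  have hk' : k p = Matrix.vecMul v (g p) := by
    ext c
    rw [hk c, Matrix.vecMul, dotProduct]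
    refine Finset.sum_congr rfl fun b _ => ?_
    rw [mul_comm, hs.apply]
  have hv : ∀ d, ∑ c, k p c * (g p)⁻¹ c d = v d := by
    intro d
    have : Matrix.vecMul (k p) (g p)⁻¹ = v := by
      rw [hk', Matrix.vecMul_vecMul, Matrix.mul_nonsing_inv _ hdet, Matrix.vecMul_one]
    exact congrFun this d
  rw [covDeriv]
  congr 1
  simp only [christoffel, Finset.mul_sum, Finset.sum_mul]
  rw [Finset.sum_comm]
  refine Finset.sum_congr rfl fun d _ => ?_
  rw [← hv d, Finset.sum_mul, Finset.mul_sum]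
  exact Finset.sum_congr rfl fun c _ => by ring

lemma lower_gradient {g : (ι → ℝ) → Matrix ι ι ℝ} {f : (ι → ℝ) → ℝ} {p : ι → ℝ}
    (hdet : IsUnit (g p).det) (c : ι) :
    ∑ b, g p c b * gradient g f p b = pd c f p := by
  have : Matrix.mulVec (g p) (Matrix.mulVec (g p)⁻¹ (fun b => pd b f p)) = fun b => pd b f p := by
    rw [Matrix.mulVec_mulVec, Matrix.mul_nonsing_inv _ hdet, Matrix.one_mulVec]
  exact congrFun this c

lemma gradient_lower {g : (ι → ℝ) → Matrix ι ι ℝ} {p v w : ι → ℝ}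
    (hdet : IsUnit (g p).det) (h : ∀ c, ∑ b, g p c b * v b = w c) (a : ι) :
    v a = ∑ b, (g p)⁻¹ a b * w b := by
  have hw : Matrix.mulVec (g p) v = w := funext h
  have : Matrix.mulVec (g p)⁻¹ w = v := by
    rw [← hw, Matrix.mulVec_mulVec, Matrix.nonsing_inv_mul _ hdet, Matrix.one_mulVec]
  exact (congrFun this a).symm

lemma ip_gradient {g : (ι → ℝ) → Matrix ι ι ℝ} {f : (ι → ℝ) → ℝ} {p : ι → ℝ}
    (hdet : IsUnit (g p).det) (v : ι → ℝ) :
    ip g p v (gradient g f p) = ∑ a, v a * pd a f p := by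
  rw [ip]
  refine Finset.sum_congr rfl fun a _ => ?_
  rw [← lower_gradient hdet a, Finset.mul_sum]
  exact Finset.sum_congr rfl fun b _ => by ring

lemma ip_gradient_gradient {g : (ι → ℝ) → Matrix ι ι ℝ} {f : (ι → ℝ) → ℝ} {p : ι → ℝ}
    (hdet : IsUnit (g p).det) :
    ip g p (gradient g f p) (gradient g f p) =
      ∑ a, ∑ b, (g p)⁻¹ a b * (pd a f p * pd b f p) := by
  rw [ip_gradient hdet]
  refine Finset.sum_congr rfl fun a _ => ?_
  rw [gradient, Finset.sum_mul]
  exact Finset.sum_congr rfl fun b _ => by ring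

lemma sum_inv_mul_self {M : Matrix ι ι ℝ} (hs : M.IsSymm) (hdet : IsUnit M.det) :
    ∑ a, ∑ b, M⁻¹ a b * M a b = Fintype.card ι := by
  have h : ∀ a, ∑ b, M⁻¹ a b * M a b = 1 := by
    intro a
    have := congrFun (congrFun (Matrix.nonsing_inv_mul M hdet) a) a
    rw [Matrix.mul_apply, Matrix.one_apply_eq] at this
    rw [← this]
    exact Finset.sum_congr rfl fun b _ => by rw [hs.apply]
  simp [h]

section Log

variable {f : (ι → ℝ) → ℝ} {p : ι → ℝ}

lemma pd_log (hf : DifferentiableAt ℝ f p) (hp : f p ≠ 0) (k : ι) :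
    pd k (fun y => Real.log (f y)) p = pd k f p / f p := by
  rw [pd, fderiv.log hf hp, pd]
  simp [div_eq_inv_mul]

lemma pd_pd_log (hf : ContDiffAt ℝ 2 f p) (hp : f p ≠ 0) (i j : ι) :
    pd j (fun y => pd i (fun z => Real.log (f z)) y) p =
      pd j (fun y => pd i f y) p / f p - pd i f p * pd j f p / (f p) ^ 2 := by
  have hd : DifferentiableAt ℝ f p := hf.differentiableAt (by norm_num)
  have hev : (fun y => pd i (fun z => Real.log (f z)) y) =ᶠ[nhds p]
      fun y => pd i f y * (f y)⁻¹ := by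
    have h1 := hf.eventually (by simp)
    have h2 := hd.continuousAt.eventually_ne hp
    filter_upwards [h1, h2] with y hy1 hy2
    rw [pd_log (hy1.differentiableAt (by norm_num)) hy2 i, div_eq_mul_inv]
  have hdi : DifferentiableAt ℝ (fun y => pd i f y) p := by
    have h1 : ContDiffAt ℝ 1 (fderiv ℝ f) p := hf.fderiv_right (by norm_num)
    exact (h1.differentiableAt (by norm_num)).clm_apply (differentiableAt_const _)
  have hinv : HasFDerivAt (fun y => (f y)⁻¹) (-((f p) ^ 2)⁻¹ • fderiv ℝ f p) p :=
    (hasDerivAt_inv hp).comp_hasFDerivAt p hd.hasFDerivAt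
  rw [pd_congr hev, pd, (hdi.hasFDerivAt.fun_mul hinv).fderiv]
  simp only [pd, smul_apply, add_apply, smul_eq_mul]
  field_simp
  ring

lemma gradient_log (g : (ι → ℝ) → Matrix ι ι ℝ) (hf : DifferentiableAt ℝ f p) (hp : f p ≠ 0) :
    gradient g (fun y => Real.log (f y)) p = (f p)⁻¹ • gradient g f p := by
  ext a
  simp only [gradient, pd_log hf hp, Pi.smul_apply, smul_eq_mul, Finset.mul_sum]
  exact Finset.sum_congr rfl fun b _ => by ring

/-- The Christoffel terms are linear in `df` and merely scale by `1/f`; only the second partial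
derivatives add `-df ⊗ df / f²`, whose trace is the gradient term. -/
lemma laplacian_log {g : (ι → ℝ) → Matrix ι ι ℝ} (hdet : IsUnit (g p).det)
    (hf : ContDiffAt ℝ 2 f p) (hp : f p ≠ 0) :
    laplacian g (fun y => Real.log (f y)) p =
      laplacian g f p / f p - ip g p (gradient g f p) (gradient g f p) / (f p) ^ 2 := by
  have hd : DifferentiableAt ℝ f p := hf.differentiableAt (by norm_num)
  rw [ip_gradient_gradient hdet]
  simp only [laplacian, Finset.sum_div, ← Finset.sum_sub_distrib]
  refine Finset.sum_congr rfl fun a _ => Finset.sum_congr rfl fun b _ => ?_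
  simp only [covDeriv, pd_pd_log hf hp, pd_log hd hp]
  rw [show ∑ c, christoffel g c a b p * (pd c f p / f p) =
    (∑ c, christoffel g c a b p * pd c f p) / f p by
      rw [Finset.sum_div]; exact Finset.sum_congr rfl fun c _ => by ring]
  ring

end Log

end Coordinates

/-! ### Joint smoothness in `(u, x)` of quantities built at fixed `u` -/

section JointSmoothness

variable {m : ℕ} {W : Set (ℝ × (Fin m → ℝ))}

/-- A partial derivative at fixed `u` is the joint derivative applied to `(0, e_k)`, so one order of
joint regularity is lost and no more. -/
lemma contDiffOn_pd {n n' : WithTop ℕ∞} {F : ℝ → (Fin m → ℝ) → ℝ} (hW : IsOpen W)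
    (hF : ContDiffOn ℝ n (fun q : ℝ × (Fin m → ℝ) => F q.1 q.2) W) (hn : n' + 1 ≤ n) (k : Fin m) :
    ContDiffOn ℝ n' (fun q : ℝ × (Fin m → ℝ) => pd k (F q.1) q.2) W := by
  have h1 := (hF.fderiv_of_isOpen hW hn).clm_apply
    (contDiffOn_const (c := ((0 : ℝ), (Pi.single k 1 : Fin m → ℝ))))
  refine h1.congr ?_
  rintro ⟨u, x⟩ hq
  have hn0 : n ≠ 0 := by
    rintro rfl
    simp at hn
  have hd : HasFDerivAt (fun q : ℝ × (Fin m → ℝ) => F q.1 q.2) _ (u, x) :=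
    ((hF.contDiffAt (hW.mem_nhds hq)).differentiableAt hn0).hasFDerivAt
  have h2 : HasFDerivAt (F u) _ x := hd.comp x (hasFDerivAt_prodMk_right u x)
  simp only [pd]
  rw [h2.fderiv]
  simp

lemma contDiffOn_deriv {n n' : WithTop ℕ∞} {F : ℝ → (Fin m → ℝ) → ℝ} (hW : IsOpen W)
    (hF : ContDiffOn ℝ n (fun q : ℝ × (Fin m → ℝ) => F q.1 q.2) W) (hn : n' + 1 ≤ n) :
    ContDiffOn ℝ n' (fun q : ℝ × (Fin m → ℝ) => deriv (fun s => F s q.2) q.1) W := by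
  have h1 := (hF.fderiv_of_isOpen hW hn).clm_apply
    (contDiffOn_const (c := ((1 : ℝ), (0 : Fin m → ℝ))))
  refine h1.congr ?_
  rintro ⟨u, x⟩ hq
  have hn0 : n ≠ 0 := by
    rintro rfl
    simp at hn
  have hd : HasFDerivAt (fun q : ℝ × (Fin m → ℝ) => F q.1 q.2) _ (u, x) :=
    ((hF.contDiffAt (hW.mem_nhds hq)).differentiableAt hn0).hasFDerivAt
  have h2 : HasFDerivAt (fun s => F s x) _ u := HasFDerivAt.comp (f := fun e => (e, x)) u hd (hasFDerivAt_prodMk_left u x)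
  rw [h2.hasDerivAt.deriv]
  simp

variable {n : WithTop ℕ∞} {E : Type*} [NormedAddCommGroup E] [NormedSpace ℝ E] {s : Set E}
  {ι : Type*} [Fintype ι] [DecidableEq ι]

lemma contDiffOn_det {M : E → Matrix ι ι ℝ} (hM : ∀ i j, ContDiffOn ℝ n (fun q => M q i j) s) :
    ContDiffOn ℝ n (fun q => (M q).det) s := by
  simp only [Matrix.det_apply]
  exact ContDiffOn.sum fun σ _ => (contDiffOn_prod fun i _ => hM _ _).const_smul _

/-- Cramer's rule: each entry is a cofactor, itself a determinant, divided by `det M`. -/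
lemma contDiffOn_matrix_inv {M : E → Matrix ι ι ℝ}
    (hM : ∀ i j, ContDiffOn ℝ n (fun q => M q i j) s) (hdet : ∀ q ∈ s, (M q).det ≠ 0) (i j : ι) :
    ContDiffOn ℝ n (fun q => (M q)⁻¹ i j) s := by
  simp only [Matrix.inv_def, Matrix.smul_apply, Ring.inverse_eq_inv', smul_eq_mul,
    Matrix.adjugate_apply]
  refine ((contDiffOn_det hM).inv hdet).mul (contDiffOn_det fun a b => ?_)
  simp only [Matrix.updateRow_apply]
  split_ifs
  · exact contDiffOn_const
  · exact hM a b

variable {g : ℝ → (Fin m → ℝ) → Matrix (Fin m) (Fin m) ℝ}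

lemma contDiffOn_christoffel (hW : IsOpen W)
    (hg : ∀ i j, ContDiffOn ℝ ∞ (fun q : ℝ × (Fin m → ℝ) => g q.1 q.2 i j) W)
    (hdet : ∀ q ∈ W, (g q.1 q.2).det ≠ 0) (c a b : Fin m) :
    ContDiffOn ℝ ∞ (fun q : ℝ × (Fin m → ℝ) => christoffel (g q.1) c a b q.2) W := by
  have hpd : ∀ k i j, ContDiffOn ℝ ∞
      (fun q : ℝ × (Fin m → ℝ) => pd k (fun y => g q.1 y i j) q.2) W := fun k i j =>
    contDiffOn_pd (F := fun u y => g u y i j) hW (hg i j) (by simp) k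
  simp only [christoffel]
  exact contDiffOn_const.mul (ContDiffOn.sum fun d _ =>
    (contDiffOn_matrix_inv (M := fun q : ℝ × (Fin m → ℝ) => g q.1 q.2) hg hdet c d).mul
      (((hpd _ _ _).add (hpd _ _ _)).sub (hpd _ _ _)))

/-- Needed because the Ricci scalar enters `H`, and hence the `r`-component of the explicit field,
which must be differentiable in all spacetime directions. -/
lemma contDiffOn_scalarCurvature (hW : IsOpen W)
    (hg : ∀ i j, ContDiffOn ℝ ∞ (fun q : ℝ × (Fin m → ℝ) => g q.1 q.2 i j) W)
    (hdet : ∀ q ∈ W, (g q.1 q.2).det ≠ 0) :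
    ContDiffOn ℝ ∞ (fun q : ℝ × (Fin m → ℝ) => scalarCurvature (g q.1) q.2) W := by
  have hΓ := contDiffOn_christoffel hW hg hdet
  have hpd : ∀ k c a b, ContDiffOn ℝ ∞
      (fun q : ℝ × (Fin m → ℝ) => pd k (christoffel (g q.1) c a b) q.2) W := fun k c a b =>
    contDiffOn_pd (F := fun u y => christoffel (g u) c a b y) hW (hΓ c a b) (by simp) k
  simp only [scalarCurvature, ricci]
  exact ContDiffOn.sum fun a _ => ContDiffOn.sum fun b _ =>
    (contDiffOn_matrix_inv (M := fun q : ℝ × (Fin m → ℝ) => g q.1 q.2) hg hdet a b).mul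
      ((ContDiffOn.sum fun c _ => (hpd _ _ _ _).sub (hpd _ _ _ _)).add
        (ContDiffOn.sum fun c _ => ContDiffOn.sum fun d _ =>
          ((hΓ _ _ _).mul (hΓ _ _ _)).sub ((hΓ _ _ _).mul (hΓ _ _ _))))

end JointSmoothness

variable {D : ℕ}

/-! ### Spacetime points and chain rules -/

section Points

@[simp] lemma mk_inl_zero (u r : ℝ) (x : Fin (D - 2) → ℝ) : mk u r x (Sum.inl 0) = u := rfl

@[simp] lemma mk_inl_one (u r : ℝ) (x : Fin (D - 2) → ℝ) : mk u r x (Sum.inl 1) = r := rfl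

@[simp] lemma mk_inr (u r : ℝ) (x : Fin (D - 2) → ℝ) (i : Fin (D - 2)) :
    mk u r x (Sum.inr i) = x i := rfl

lemma sum_idx (f : Idx D → ℝ) :
    ∑ a, f a = f (Sum.inl 0) + f (Sum.inl 1) + ∑ i, f (Sum.inr i) := by
  rw [Fintype.sum_sum_type, Fin.sum_univ_two]

/-- The chain rule along a curve through `mk u r x` whose components are given. -/
lemma hasFDerivAt_mk {E : Type*} [NormedAddCommGroup E] [NormedSpace ℝ E] {U R : E → ℝ}
    {X : E → Fin (D - 2) → ℝ} {e : E} {U' R' : E →L[ℝ] ℝ} {X' : E →L[ℝ] (Fin (D - 2) → ℝ)}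
    (hU : HasFDerivAt U U' e) (hR : HasFDerivAt R R' e) (hX : HasFDerivAt X X' e) :
    ∃ L : E →L[ℝ] (Idx D → ℝ), HasFDerivAt (fun y => mk (U y) (R y) (X y)) L e ∧
      ∀ v, L v = mk (U' v) (R' v) (X' v) := by
  refine ⟨ContinuousLinearMap.pi (Sum.elim ![U', R']
    fun i => (ContinuousLinearMap.proj (R := ℝ) (φ := fun _ => ℝ) i).comp X'), ?_, ?_⟩
  · rw [hasFDerivAt_pi]
    rintro (a | i)
    · fin_cases a
      · exact hU
      · exact hR
    · exact hasFDerivAt_pi'.1 hX i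
  · intro v
    ext a
    rcases a with a | i
    · fin_cases a <;> rfl
    · rfl

lemma mk_zero_zero_single (k : Fin (D - 2)) :
    mk 0 0 (Pi.single k 1) = (Pi.single (Sum.inr k) 1 : Idx D → ℝ) := by
  ext a
  rcases a with a | i
  · fin_cases a <;> simp [mk]
  · simp [mk, Pi.single_apply]

lemma mk_one_zero_zero : mk 1 0 0 = (Pi.single (Sum.inl 0) 1 : Idx D → ℝ) := by
  ext a
  rcases a with a | i
  · fin_cases a <;> simp [mk]
  · simp [mk]

lemma mk_zero_one_zero : mk 0 1 0 = (Pi.single (Sum.inl 1) 1 : Idx D → ℝ) := by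
  ext a
  rcases a with a | i
  · fin_cases a <;> simp [mk]
  · simp [mk]

variable {f : (Idx D → ℝ) → ℝ} {u r : ℝ} {x : Fin (D - 2) → ℝ}

lemma pd_inr (hf : DifferentiableAt ℝ f (mk u r x)) (k : Fin (D - 2)) :
    pd (Sum.inr k) f (mk u r x) = pd k (fun y => f (mk u r y)) x := by
  obtain ⟨L, hL, hLv⟩ := hasFDerivAt_mk (hasFDerivAt_const u x) (hasFDerivAt_const r x)
    (hasFDerivAt_id x)
  have h : HasFDerivAt (fun y => f (mk u r y)) _ x := HasFDerivAt.comp x hf.hasFDerivAt hL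
  rw [pd, pd, h.fderiv, ContinuousLinearMap.comp_apply, hLv, ← mk_zero_zero_single]
  rfl

lemma pd_inl_zero (hf : DifferentiableAt ℝ f (mk u r x)) :
    pd (Sum.inl 0) f (mk u r x) = deriv (fun s => f (mk s r x)) u := by
  obtain ⟨L, hL, hLv⟩ := hasFDerivAt_mk (hasFDerivAt_id u) (hasFDerivAt_const r u)
    (hasFDerivAt_const x u)
  have h : HasFDerivAt (fun s => f (mk s r x)) _ u := HasFDerivAt.comp u hf.hasFDerivAt hL
  rw [pd, h.hasDerivAt.deriv, ContinuousLinearMap.comp_apply, hLv, ← mk_one_zero_zero]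
  rfl

lemma pd_inl_one (hf : DifferentiableAt ℝ f (mk u r x)) :
    pd (Sum.inl 1) f (mk u r x) = deriv (fun s => f (mk u s x)) r := by
  obtain ⟨L, hL, hLv⟩ := hasFDerivAt_mk (hasFDerivAt_const u r) (hasFDerivAt_id r)
    (hasFDerivAt_const x r)
  have h : HasFDerivAt (fun s => f (mk u s x)) _ r := HasFDerivAt.comp r hf.hasFDerivAt hL
  rw [pd, h.hasDerivAt.deriv, ContinuousLinearMap.comp_apply, hLv, ← mk_zero_one_zero]
  rfl

/-- The chain rule for the tangent vector `∂_k + R_{,k} ∂_r` of a section; this is how data known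
only on the hypersurface yields derivative information. -/
lemma pd_section {R : (Fin (D - 2) → ℝ) → ℝ} (hR : DifferentiableAt ℝ R x)
    (hf : DifferentiableAt ℝ f (mk u (R x) x)) (k : Fin (D - 2)) :
    pd k (fun y => f (mk u (R y) y)) x =
      pd k R x * pd (Sum.inl 1) f (mk u (R x) x) + pd (Sum.inr k) f (mk u (R x) x) := by
  obtain ⟨L, hL, hLv⟩ := hasFDerivAt_mk (hasFDerivAt_const u x) hR.hasFDerivAt
    (hasFDerivAt_id x)
  have h : HasFDerivAt (fun y => f (mk u (R y) y)) _ x := HasFDerivAt.comp x hf.hasFDerivAt hL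
  rw [pd, h.fderiv, ContinuousLinearMap.comp_apply, hLv, fderiv_apply_eq_sum, sum_idx]
  simp [pd, Pi.single_apply]

end Points

variable (S : Data D)

/-! ### Components, symmetry and inverse of the metric -/

section Components

variable (q : Idx D → ℝ) (i j : Fin (D - 2))

@[simp] lemma metric_uu : S.metric q (Sum.inl 0) (Sum.inl 0) =
    -2 * S.H (q (Sum.inl 0)) (q (Sum.inl 1)) (fun i => q (Sum.inr i)) := rfl

@[simp] lemma metric_ur : S.metric q (Sum.inl 0) (Sum.inl 1) = -1 := rfl

@[simp] lemma metric_ru : S.metric q (Sum.inl 1) (Sum.inl 0) = -1 := rfl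

@[simp] lemma metric_rr : S.metric q (Sum.inl 1) (Sum.inl 1) = 0 := rfl

@[simp] lemma metric_inl_inr (a : Fin 2) : S.metric q (Sum.inl a) (Sum.inr i) = 0 := rfl

@[simp] lemma metric_inr_inl (a : Fin 2) : S.metric q (Sum.inr i) (Sum.inl a) = 0 := rfl

@[simp] lemma metric_inr_inr : S.metric q (Sum.inr i) (Sum.inr j) =
    (q (Sum.inl 1)) ^ 2 * S.h (q (Sum.inl 0)) (fun i => q (Sum.inr i)) i j := rfl

end Components

lemma h_apply (u : ℝ) (x : Fin (D - 2) → ℝ) (i j : Fin (D - 2)) :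
    S.h u x i j = ((S.P u x) ^ 2)⁻¹ * S.γ x i j := rfl

variable {S} {u r : ℝ} {x : Fin (D - 2) → ℝ}

lemma h_posDef (hq : (u, x) ∈ S.W) : (S.h u x).PosDef := by
  have hP : 0 < S.P u x := S.P_pos _ hq
  exact (S.γ_posDef x ⟨_, hq, rfl⟩).smul (by positivity)

lemma h_isSymm (hq : (u, x) ∈ S.W) : (S.h u x).IsSymm := by
  have := (h_posDef hq).isHermitian
  rwa [Matrix.IsHermitian, Matrix.conjTranspose_eq_transpose_of_trivial] at this

lemma h_det (hq : (u, x) ∈ S.W) : IsUnit (S.h u x).det :=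
  (h_posDef hq).det_pos.ne'.isUnit

lemma metric_isSymm (hq : (u, x) ∈ S.W) : (S.metric (mk u r x)).IsSymm := by
  have hs := (h_isSymm hq).apply
  ext a b
  rw [Matrix.transpose_apply]
  rcases a with a | i <;> rcases b with b | j
  · fin_cases a <;> fin_cases b <;> rfl
  · simp
  · simp
  · simp [hs i j]

/-- The components of the inverse metric. -/
noncomputable def invMetric (S : Data D) (u r : ℝ) (x : Fin (D - 2) → ℝ) :
    Matrix (Idx D) (Idx D) ℝ :=
  Matrix.fromBlocks !![0, -1; -1, 2 * S.H u r x] 0 0 ((r ^ 2)⁻¹ • (S.h u x)⁻¹)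

lemma metric_mul_invMetric (hq : (u, x) ∈ S.W) (hr : r ≠ 0) :
    S.metric (mk u r x) * invMetric S u r x = 1 := by
  have h1 : (r ^ 2 • S.h u x) * ((r ^ 2)⁻¹ • (S.h u x)⁻¹) = 1 := by
    rw [Matrix.smul_mul, Matrix.mul_smul, smul_smul, mul_inv_cancel₀ (pow_ne_zero 2 hr), one_smul,
      Matrix.mul_nonsing_inv _ (h_det hq)]
  have h2 : !![-2 * S.H u r x, -1; -1, 0] * !![0, -1; -1, 2 * S.H u r x] = 1 := by
    rw [Matrix.mul_fin_two, Matrix.one_fin_two]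
    congr 1
    ext a b
    fin_cases a <;> fin_cases b <;> simp
  have h3 : S.metric (mk u r x) =
    Matrix.fromBlocks !![-2 * S.H u r x, -1; -1, 0] 0 0 (r ^ 2 • S.h u x) := rfl
  rw [h3, invMetric, Matrix.fromBlocks_multiply, h1, h2]
  simp

lemma metric_inv (hq : (u, x) ∈ S.W) (hr : r ≠ 0) :
    (S.metric (mk u r x))⁻¹ = invMetric S u r x :=
  Matrix.inv_eq_right_inv (metric_mul_invMetric hq hr)

lemma metric_det (hq : (u, x) ∈ S.W) (hr : r ≠ 0) : IsUnit (S.metric (mk u r x)).det :=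
  Matrix.isUnit_det_of_right_inverse (metric_mul_invMetric hq hr)

/-! ### Derivatives of the spatial block and differentiability of `H` -/

section Derivatives

variable (S) in
lemma contDiffOn_h (i j : Fin (D - 2)) :
    ContDiffOn ℝ ∞ (fun q : ℝ × (Fin (D - 2) → ℝ) => S.h q.1 q.2 i j) S.W := by
  simp only [h_apply]
  refine ((S.P_smooth.pow 2).inv fun q hq => pow_ne_zero 2 (S.P_pos q hq).ne').mul ?_
  exact (S.γ_smooth i j).comp contDiffOn_snd (Set.mapsTo_image _ _)

lemma differentiableAt_comp_coords {F : ℝ × (Fin (D - 2) → ℝ) → ℝ}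
    (hF : DifferentiableAt ℝ F (u, x)) :
    DifferentiableAt ℝ (fun q : Idx D → ℝ => F (q (Sum.inl 0), fun i => q (Sum.inr i)))
      (mk u r x) := by
  have h : DifferentiableAt ℝ
      (fun q : Idx D → ℝ => (q (Sum.inl 0), fun i => q (Sum.inr i))) (mk u r x) := by
    fun_prop
  exact DifferentiableAt.comp (mk u r x) hF h

lemma differentiableAt_of_contDiffOn {F : ℝ × (Fin (D - 2) → ℝ) → ℝ} {n : WithTop ℕ∞}
    (hF : ContDiffOn ℝ n F S.W) (hn : n ≠ 0) (hq : (u, x) ∈ S.W) :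
    DifferentiableAt ℝ F (u, x) :=
  (hF.contDiffAt (S.isOpen_W.mem_nhds hq)).differentiableAt hn

lemma differentiableAt_h (hq : (u, x) ∈ S.W) (i j : Fin (D - 2)) :
    DifferentiableAt ℝ (fun q : ℝ × (Fin (D - 2) → ℝ) => S.h q.1 q.2 i j) (u, x) :=
  differentiableAt_of_contDiffOn (contDiffOn_h S i j) (by simp) hq

lemma differentiableAt_metric_inr (hq : (u, x) ∈ S.W) (i j : Fin (D - 2)) :
    DifferentiableAt ℝ (fun q => S.metric q (Sum.inr i) (Sum.inr j)) (mk u r x) := by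
  simp only [metric_inr_inr]
  have := differentiableAt_comp_coords (r := r) (differentiableAt_h hq i j)
  fun_prop

lemma pd_r_metric (hq : (u, x) ∈ S.W) (i j : Fin (D - 2)) :
    pd (Sum.inl 1) (fun q => S.metric q (Sum.inr i) (Sum.inr j)) (mk u r x) =
      2 * r * S.h u x i j := by
  rw [pd_inl_one (differentiableAt_metric_inr hq i j)]
  simp

lemma pd_x_metric (hq : (u, x) ∈ S.W) (k i j : Fin (D - 2)) :
    pd (Sum.inr k) (fun q => S.metric q (Sum.inr i) (Sum.inr j)) (mk u r x) =
      r ^ 2 * pd k (fun y => S.h u y i j) x := by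
  rw [pd_inr (differentiableAt_metric_inr hq i j)]
  have hd : DifferentiableAt ℝ (fun y => S.h u y i j) x :=
    DifferentiableAt.comp (f := fun y => (u, y)) x (differentiableAt_h hq i j) (by fun_prop)
  simp only [metric_inr_inr, mk_inl_zero, mk_inl_one, mk_inr, pd]
  rw [fderiv_const_mul hd]
  rfl

lemma differentiableAt_P (hq : (u, x) ∈ S.W) : DifferentiableAt ℝ (fun s => S.P s x) u :=
  DifferentiableAt.comp (f := fun s => (s, x)) u
    (differentiableAt_of_contDiffOn S.P_smooth (by simp) hq) (by fun_prop)

/-- Since `γ` does not depend on `u`, the only `u`-dependence is the factor `P⁻²`, with logarithmic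
derivative `-2 (ln P)_{,u}`. -/
lemma pd_u_metric (hq : (u, x) ∈ S.W) (i j : Fin (D - 2)) :
    pd (Sum.inl 0) (fun q => S.metric q (Sum.inr i) (Sum.inr j)) (mk u r x) =
      -(2 * r ^ 2 * deriv (fun s => Real.log (S.P s x)) u * S.h u x i j) := by
  have hP : S.P u x ≠ 0 := (S.P_pos _ hq).ne'
  have hd := differentiableAt_P hq
  rw [pd_inl_zero (differentiableAt_metric_inr hq i j)]
  simp only [metric_inr_inr, mk_inl_zero, mk_inl_one, mk_inr, h_apply]
  rw [deriv.log hd hP]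
  have h1 := (((hd.hasDerivAt.fun_pow 2).fun_inv (pow_ne_zero 2 hP)).mul_const
    (S.γ x i j)).const_mul (r ^ 2)
  rw [h1.deriv]
  push_cast
  field_simp

lemma contDiffOn_slice {n : WithTop ℕ∞} {R : ℝ → (Fin (D - 2) → ℝ) → ℝ}
    (hR : ContDiffOn ℝ n (fun q : ℝ × (Fin (D - 2) → ℝ) => R q.1 q.2) S.W) (hq : (u, x) ∈ S.W) :
    ContDiffAt ℝ n (R u) x :=
  ContDiffAt.comp (f := fun y => (u, y)) x (hR.contDiffAt (S.isOpen_W.mem_nhds hq)) (by fun_prop)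

lemma eventually_mem_W (hq : (u, x) ∈ S.W) : ∀ᶠ y in nhds x, (u, y) ∈ S.W :=
  (Continuous.prodMk_right u).continuousAt.eventually (S.isOpen_W.mem_nhds hq)

lemma differentiableAt_H (hq : (u, x) ∈ S.W) (hr : r ≠ 0) :
    DifferentiableAt ℝ (fun q : Idx D → ℝ =>
      S.H (q (Sum.inl 0)) (q (Sum.inl 1)) (fun i => q (Sum.inr i))) (mk u r x) := by
  have h1 := differentiableAt_comp_coords (r := r) (differentiableAt_of_contDiffOn
    (contDiffOn_scalarCurvature S.isOpen_W (contDiffOn_h S) fun q hq => (h_det hq).ne_zero)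
    (by simp) hq)
  have h2 := differentiableAt_comp_coords (r := r) (differentiableAt_of_contDiffOn
    (contDiffOn_deriv (F := fun s y => Real.log (S.P s y)) (n := ∞) (n' := ∞) S.isOpen_W
      (S.P_smooth.log fun q hq => (S.P_pos q hq).ne') (by simp)) (by simp) hq)
  have h3 := differentiableAt_comp_coords (r := r) (differentiableAt_of_contDiffOn
    (S.μ_smooth.comp contDiffOn_fst (Set.mapsTo_image _ _)) (by simp) hq)
  simp only [Function.comp_def] at h3
  have h4 : DifferentiableAt ℝ (fun q : Idx D → ℝ => q (Sum.inl 1)) (mk u r x) := by fun_prop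
  have h5 : DifferentiableAt ℝ (fun q : Idx D → ℝ => (q (Sum.inl 1) ^ (D - 3))⁻¹) (mk u r x) :=
    (h4.fun_pow (D - 3)).fun_inv (pow_ne_zero _ hr)
  simp only [Data.H, div_eq_mul_inv]
  exact ((((h1.mul_const _).fun_sub ((h4.const_mul 2).fun_mul h2)).fun_sub
    ((h4.fun_pow 2).const_mul _)).fun_sub (h3.fun_mul h5)).const_mul _

end Derivatives

/-! ### Components of the projector -/

section Projector

lemma ip_metric (v w : Idx D → ℝ) :
    ip S.metric (mk u r x) v w =
      -2 * S.H u r x * v (Sum.inl 0) * w (Sum.inl 0) - v (Sum.inl 0) * w (Sum.inl 1)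
        - v (Sum.inl 1) * w (Sum.inl 0)
        + r ^ 2 * ip (S.h u) x (fun i => v (Sum.inr i)) (fun i => w (Sum.inr i)) := by
  simp only [ip, sum_idx, metric_uu, metric_ur, metric_ru, metric_rr, metric_inl_inr,
    metric_inr_inl, metric_inr_inr, mk_inl_zero, mk_inl_one, mk_inr, zero_mul,
    Finset.sum_const_zero, add_zero, zero_add, Finset.mul_sum, mul_assoc]
  ring

lemma ip_outgoing (q v : Idx D → ℝ) :
    ip S.metric (mk u r x) (outgoing q) v = -v (Sum.inl 0) := by
  rw [ip_metric]
  simp [outgoing, ip]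

variable {n : Idx D → ℝ} (hq : (u, x) ∈ S.W) (hr : r ≠ 0) (hn : n (Sum.inl 0) = 1)

include hq hr

lemma projector_ij (q : Idx D → ℝ) (i j : Fin (D - 2)) :
    projector S.metric (mk u r x) (outgoing q) n (Sum.inr i) (Sum.inr j) =
      (r ^ 2)⁻¹ * (S.h u x)⁻¹ i j := by
  simp [projector, metric_inv hq hr, invMetric, outgoing]

lemma projector_uu (q : Idx D → ℝ) :
    projector S.metric (mk u r x) (outgoing q) n (Sum.inl 0) (Sum.inl 0) = 0 := by
  simp [projector, metric_inv hq hr, invMetric, outgoing]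

lemma projector_ui (q : Idx D → ℝ) (i : Fin (D - 2)) :
    projector S.metric (mk u r x) (outgoing q) n (Sum.inl 0) (Sum.inr i) = 0 := by
  simp [projector, metric_inv hq hr, invMetric, outgoing]

lemma projector_iu (q : Idx D → ℝ) (i : Fin (D - 2)) :
    projector S.metric (mk u r x) (outgoing q) n (Sum.inr i) (Sum.inl 0) = 0 := by
  simp [projector, metric_inv hq hr, invMetric, outgoing]

lemma projector_ri (q : Idx D → ℝ) (i : Fin (D - 2)) :
    projector S.metric (mk u r x) (outgoing q) n (Sum.inl 1) (Sum.inr i) = n (Sum.inr i) := by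
  simp [projector, metric_inv hq hr, invMetric, outgoing]

lemma projector_ir (q : Idx D → ℝ) (i : Fin (D - 2)) :
    projector S.metric (mk u r x) (outgoing q) n (Sum.inr i) (Sum.inl 1) = n (Sum.inr i) := by
  simp [projector, metric_inv hq hr, invMetric, outgoing]

lemma projector_rr (q : Idx D → ℝ) :
    projector S.metric (mk u r x) (outgoing q) n (Sum.inl 1) (Sum.inl 1) =
      2 * S.H u r x + 2 * n (Sum.inl 1) := by
  simp [projector, metric_inv hq hr, invMetric, outgoing]
  ring

include hn

lemma projector_ur (q : Idx D → ℝ) :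
    projector S.metric (mk u r x) (outgoing q) n (Sum.inl 0) (Sum.inl 1) = 0 := by
  simp [projector, metric_inv hq hr, invMetric, outgoing, hn]

lemma projector_ru (q : Idx D → ℝ) :
    projector S.metric (mk u r x) (outgoing q) n (Sum.inl 1) (Sum.inl 0) = 0 := by
  simp [projector, metric_inv hq hr, invMetric, outgoing, hn]

/-- The projector has no components along `du`, so only the remaining ones contribute to an
expansion. -/
lemma sum_mul_projector (q : Idx D → ℝ) (C : Idx D → Idx D → ℝ) :
    ∑ a, ∑ b, C a b * projector S.metric (mk u r x) (outgoing q) n a b =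
      C (Sum.inl 1) (Sum.inl 1) * (2 * S.H u r x + 2 * n (Sum.inl 1))
      + ∑ j, n (Sum.inr j) * C (Sum.inl 1) (Sum.inr j)
      + ∑ j, n (Sum.inr j) * C (Sum.inr j) (Sum.inl 1)
      + (r ^ 2)⁻¹ * ∑ i, ∑ j, (S.h u x)⁻¹ i j * C (Sum.inr i) (Sum.inr j) := by
  simp only [sum_idx, projector_uu hq hr, projector_ur hq hr hn, projector_ru hq hr hn,
    projector_ui hq hr, projector_iu hq hr, projector_ri hq hr, projector_ir hq hr,
    projector_rr hq hr, projector_ij hq hr, mul_zero, Finset.sum_const_zero, add_zero, zero_add,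
    Finset.sum_add_distrib, Finset.mul_sum]
  simp only [mul_comm, mul_left_comm]
  ring

end Projector

/-! ### Covariant derivative of a lowered field -/

section CovariantDerivative

variable {n : (Idx D → ℝ) → Idx D → ℝ} (hq : (u, x) ∈ S.W) (hr : r ≠ 0)

include hq hr

lemma covDeriv_lower (a b : Idx D) :
    covDeriv S.metric (lower S.metric n) a b (mk u r x) =
      pd b (fun q => lower S.metric n q a) (mk u r x) - (1 / 2) * ∑ d, n (mk u r x) d *
        (pd a (fun q => S.metric q d b) (mk u r x) + pd b (fun q => S.metric q d a) (mk u r x)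
          - pd d (fun q => S.metric q a b) (mk u r x)) :=
  covDeriv_eq (metric_isSymm hq) (metric_det hq hr) (fun _ => rfl) a b

/-- The Christoffel terms drop out because the metric components in the `r` row and column are
constant. For the same reason `H` is never differentiated here or in the mixed and spatial
components below. -/
lemma covDeriv_rr :
    covDeriv S.metric (lower S.metric n) (Sum.inl 1) (Sum.inl 1) (mk u r x) =
      pd (Sum.inl 1) (fun q => lower S.metric n q (Sum.inl 1)) (mk u r x) := by
  rw [covDeriv_lower hq hr, sum_idx]
  simp

lemma covDeriv_rj (j : Fin (D - 2)) :
    covDeriv S.metric (lower S.metric n) (Sum.inl 1) (Sum.inr j) (mk u r x) =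
      pd (Sum.inr j) (fun q => lower S.metric n q (Sum.inl 1)) (mk u r x)
        - r * ∑ k, n (mk u r x) (Sum.inr k) * S.h u x k j := by
  rw [covDeriv_lower hq hr, sum_idx]
  simp only [metric_inl_inr, metric_inr_inl, metric_rr, metric_ur, pd_const, pd_r_metric hq,
    Finset.mul_sum, add_zero, sub_zero, mul_zero, zero_add]
  congr 1
  exact Finset.sum_congr rfl fun k _ => by ring

lemma covDeriv_jr (j : Fin (D - 2)) :
    covDeriv S.metric (lower S.metric n) (Sum.inr j) (Sum.inl 1) (mk u r x) =
      pd (Sum.inl 1) (fun q => lower S.metric n q (Sum.inr j)) (mk u r x)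
        - r * ∑ k, n (mk u r x) (Sum.inr k) * S.h u x k j := by
  rw [covDeriv_lower hq hr, sum_idx]
  simp only [metric_inl_inr, metric_inr_inl, metric_rr, metric_ur, pd_const, pd_r_metric hq,
    Finset.mul_sum, add_zero, sub_zero, mul_zero, zero_add]
  congr 1
  exact Finset.sum_congr rfl fun k _ => by ring

/-- The spatial components, for a vector field whose spatial part at the given point is
`r⁻²` times the `h`-gradient of `f`. -/
lemma covDeriv_ij {f : (Fin (D - 2) → ℝ) → ℝ} (hn : n (mk u r x) (Sum.inl 0) = 1)
    (hf : ∀ i, n (mk u r x) (Sum.inr i) = (r ^ 2)⁻¹ * gradient (S.h u) f x i)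
    (i j : Fin (D - 2)) :
    covDeriv S.metric (lower S.metric n) (Sum.inr i) (Sum.inr j) (mk u r x) =
      pd (Sum.inr j) (fun q => lower S.metric n q (Sum.inr i)) (mk u r x)
        - pd j (fun y => pd i f y) x + covDeriv (S.h u) (fun y c => pd c f y) i j x
        + (r * n (mk u r x) (Sum.inl 1) - r ^ 2 * deriv (fun s => Real.log (S.P s x)) u)
          * S.h u x i j := by
  -- Both the `h`-Hessian of `f` and the spacetime derivative are put in inverse-free form; the
  -- factor `r⁻²` in `n^k` cancels the `r²` of the spatial block, so the spatial brackets coincide.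
  rw [covDeriv_eq (h_isSymm hq) (h_det hq) (fun c => (lower_gradient (h_det hq) c).symm),
    covDeriv_lower hq hr, sum_idx]
  simp only [metric_inl_inr, pd_const, pd_r_metric hq, pd_x_metric hq, pd_u_metric hq, hn, hf]
  have : ∑ k, (r ^ 2)⁻¹ * gradient (S.h u) f x k * (r ^ 2 * pd i (fun y => S.h u y k j) x
      + r ^ 2 * pd j (fun y => S.h u y k i) x - r ^ 2 * pd k (fun y => S.h u y i j) x) =
      ∑ k, gradient (S.h u) f x k * (pd i (fun y => S.h u y k j) x
        + pd j (fun y => S.h u y k i) x - pd k (fun y => S.h u y i j) x) :=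
    Finset.sum_congr rfl fun k _ => by field_simp
  rw [this]
  ring

end CovariantDerivative

/-! ### Expansion of the outgoing congruence -/

lemma expansion_outgoing (hD : 4 ≤ D) {n : (Idx D → ℝ) → Idx D → ℝ} (hq : (u, x) ∈ S.W)
    (hr : r ≠ 0) (hn : n (mk u r x) (Sum.inl 0) = 1) :
    expansion S.metric outgoing n outgoing (mk u r x) = ((D : ℝ) - 2) / r := by
  have hl : lower S.metric outgoing = fun _ => mk (-1) 0 0 := by
    ext q a
    rw [lower, sum_idx]
    rcases a with a | i
    · fin_cases a <;> simp [outgoing]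
    · simp [outgoing]
  have hij : ∀ i j, covDeriv S.metric (lower S.metric outgoing) (Sum.inr i) (Sum.inr j)
      (mk u r x) = r * S.h u x i j := by
    intro i j
    rw [covDeriv_lower hq hr, sum_idx, hl]
    -- The spatial block must stay folded for `pd_r_metric` to match.
    simp [outgoing, pd_r_metric hq, -metric_inr_inr]
    ring
  have hcard : ((D - 2 : ℕ) : ℝ) = (D : ℝ) - 2 := by
    rw [Nat.cast_sub (by omega)]; norm_num
  rw [expansion, sum_mul_projector hq hr hn, covDeriv_rr hq hr]
  simp only [covDeriv_rj hq hr, covDeriv_jr hq hr, hij, mul_left_comm _ r, ← Finset.mul_sum]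
  rw [sum_inv_mul_self (h_isSymm hq) (h_det hq), Fintype.card_fin, hcard, hl]
  simp [outgoing]
  field_simp

/-! ### Ingoing congruences of the hypersurface -/

section Hypersurface

variable {R : ℝ → (Fin (D - 2) → ℝ) → ℝ} {n : (Idx D → ℝ) → Idx D → ℝ}

lemma sectionTangent_u (i : Fin (D - 2)) : sectionTangent R u x i (Sum.inl 0) = 0 := by
  simp [sectionTangent]

lemma sectionTangent_r (i : Fin (D - 2)) : sectionTangent R u x i (Sum.inl 1) = pd i (R u) x := by
  simp [sectionTangent]

lemma sectionTangent_x (i : Fin (D - 2)) :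
    (fun j => sectionTangent R u x i (Sum.inr j)) = Pi.single i 1 := by
  ext j
  simp [sectionTangent, pd_coord, Pi.single_apply]

lemma ip_sectionTangent (v : Idx D → ℝ) (hq : (u, x) ∈ S.W) (i : Fin (D - 2)) :
    ip S.metric (mk u r x) v (sectionTangent R u x i) =
      -(v (Sum.inl 0) * pd i (R u) x) + r ^ 2 * ∑ j, S.h u x i j * v (Sum.inr j) := by
  rw [ip_metric, sectionTangent_u, sectionTangent_r, sectionTangent_x]
  simp [ip, Pi.single_apply, (h_isSymm hq).apply]

variable (hR : ContDiffOn ℝ 2 (fun q : ℝ × (Fin (D - 2) → ℝ) => R q.1 q.2) S.W)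
  (hRpos : ∀ u x, (u, x) ∈ S.W → 0 < R u x)

include hR hRpos in
theorem isIngoing_ingoing : IsIngoing S R (ingoing S R) where
  differentiable u x hq := by
    have hr : R u x ≠ 0 := (hRpos u x hq).ne'
    -- Since `R` is `C²`, its gradient is `C¹`, which suffices for a differentiable field.
    have hpd : ∀ k, ContDiffOn ℝ 1
        (fun q : ℝ × (Fin (D - 2) → ℝ) => pd k (R q.1) q.2) S.W := fun k =>
      contDiffOn_pd S.isOpen_W hR (by norm_num) k
    have hgrad : ∀ k, ContDiffOn ℝ 1
        (fun q : ℝ × (Fin (D - 2) → ℝ) => gradient (S.h q.1) (R q.1) q.2 k) S.W := fun k => by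
      simp only [gradient]
      exact ContDiffOn.sum fun b _ => (((contDiffOn_matrix_inv
        (M := fun q : ℝ × (Fin (D - 2) → ℝ) => S.h q.1 q.2) (contDiffOn_h S)
        (fun q hq => (h_det hq).ne_zero) k b)).of_le (by simp)).mul (hpd b)
    have hip : ContDiffOn ℝ 1 (fun q : ℝ × (Fin (D - 2) → ℝ) => ip (S.h q.1) q.2
        (gradient (S.h q.1) (R q.1) q.2) (gradient (S.h q.1) (R q.1) q.2)) S.W := by
      simp only [ip]
      exact ContDiffOn.sum fun a _ => ContDiffOn.sum fun b _ =>
        (((contDiffOn_h S a b).of_le (by simp)).mul (hgrad a)).mul (hgrad b)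
    have hinv : DifferentiableAt ℝ (fun q : Idx D → ℝ => (q (Sum.inl 1) ^ 2)⁻¹)
        (mk u (R u x) x) :=
      DifferentiableAt.fun_inv (by fun_prop) (pow_ne_zero 2 hr)
    rw [differentiableAt_pi]
    rintro (a | i)
    · fin_cases a
      · exact differentiableAt_const _
      · exact (differentiableAt_H hq hr).fun_neg.fun_add ((hinv.fun_mul
          (differentiableAt_comp_coords (differentiableAt_of_contDiffOn hip (by simp) hq))).const_mul
            (1 / 2))
    · exact hinv.fun_mul
        (differentiableAt_comp_coords (differentiableAt_of_contDiffOn (hgrad i) (by simp) hq))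
  null u x hq := by
    have hr : R u x ≠ 0 := (hRpos u x hq).ne'
    have hx : (fun i => ingoing S R (mk u (R u x) x) (Sum.inr i)) =
      (R u x ^ 2)⁻¹ • gradient (S.h u) (R u) x := rfl
    rw [ip_metric, hx, ip_smul_smul]
    simp only [ingoing, mk_inl_zero, mk_inl_one, mk_inr]
    field_simp
    ring
  normalized u x hq := by
    rw [ip_outgoing]
    rfl
  orthogonal u x hq i := by
    have hr : R u x ≠ 0 := (hRpos u x hq).ne'
    rw [ip_sectionTangent _ hq]
    simp only [ingoing, mk_inl_zero, mk_inl_one, mk_inr, Pi.smul_apply, smul_eq_mul,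
      mul_left_comm _ (R u x ^ 2)⁻¹, ← Finset.mul_sum, lower_gradient (h_det hq)]
    field_simp
    ring

section Ingoing

lemma differentiableAt_lower_r (hd : DifferentiableAt ℝ n (mk u r x)) :
    DifferentiableAt ℝ (fun q => lower S.metric n q (Sum.inl 1)) (mk u r x) := by
  have hd' := differentiableAt_pi.1 hd
  simp only [lower, sum_idx, metric_ru, metric_rr, metric_inl_inr, zero_mul,
    Finset.sum_const_zero, add_zero]
  exact (hd' _).const_mul _

lemma differentiableAt_lower_i (hq : (u, x) ∈ S.W) (hd : DifferentiableAt ℝ n (mk u r x)) (i : Fin (D - 2)) :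
    DifferentiableAt ℝ (fun q => lower S.metric n q (Sum.inr i)) (mk u r x) := by
  have hd' := differentiableAt_pi.1 hd
  simp only [lower, sum_idx, metric_inr_inl, zero_mul, zero_add]
  exact DifferentiableAt.fun_sum fun j _ => (differentiableAt_metric_inr hq i j).fun_mul (hd' _)

variable (hn : IsIngoing S R n) (hq : (u, x) ∈ S.W)

include hn hq

lemma ingoing_comp_u : n (mk u (R u x) x) (Sum.inl 0) = 1 := by
  have := hn.normalized u x hq
  rw [ip_outgoing] at this
  linarith

lemma ingoing_sum_h_mul (i : Fin (D - 2)) :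
    R u x ^ 2 * ∑ j, S.h u x i j * n (mk u (R u x) x) (Sum.inr j) = pd i (R u) x := by
  have := hn.orthogonal u x hq i
  rw [ip_sectionTangent _ hq, ingoing_comp_u hn hq] at this
  linarith

lemma ingoing_comp_x (hr : R u x ≠ 0) (i : Fin (D - 2)) :
    n (mk u (R u x) x) (Sum.inr i) = (R u x ^ 2)⁻¹ * gradient (S.h u) (R u) x i := by
  have h := gradient_lower (w := fun c => (R u x ^ 2)⁻¹ * pd c (R u) x) (h_det hq)
    (fun c => by rw [← ingoing_sum_h_mul hn hq c, inv_mul_cancel_left₀ (pow_ne_zero 2 hr)]) i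
  rw [h, gradient, Finset.mul_sum]
  exact Finset.sum_congr rfl fun b _ => by ring

/-- With `n^u` and `n^i` known, the null condition is linear in `n^r`. -/
lemma ingoing_comp_r (hr : R u x ≠ 0) :
    n (mk u (R u x) x) (Sum.inl 1) = -S.H u (R u x) x + (1 / 2) * ((R u x ^ 2)⁻¹ *
      ip (S.h u) x (gradient (S.h u) (R u) x) (gradient (S.h u) (R u) x)) := by
  have hx : (fun i => n (mk u (R u x) x) (Sum.inr i)) =
    (R u x ^ 2)⁻¹ • gradient (S.h u) (R u) x := funext (ingoing_comp_x hn hq hr)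
  have := hn.null u x hq
  rw [ip_metric, hx, ip_smul_smul, ingoing_comp_u hn hq] at this
  have h2 : (R u x ^ 2) * ((R u x ^ 2)⁻¹ * (R u x ^ 2)⁻¹ * ip (S.h u) x
      (gradient (S.h u) (R u) x) (gradient (S.h u) (R u) x)) =
      (R u x ^ 2)⁻¹ * ip (S.h u) x (gradient (S.h u) (R u) x) (gradient (S.h u) (R u) x) := by
    field_simp
  rw [h2] at this
  linarith

lemma ingoing_lower_r : lower S.metric n (mk u (R u x) x) (Sum.inl 1) = -1 := by
  rw [lower, sum_idx, ingoing_comp_u hn hq]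
  simp

lemma ingoing_lower_i (i : Fin (D - 2)) :
    lower S.metric n (mk u (R u x) x) (Sum.inr i) = pd i (R u) x := by
  rw [lower, sum_idx, ← ingoing_sum_h_mul hn hq i, Finset.mul_sum]
  simp [mul_assoc]

include hR

/-- As `W` is open, `n_r = -1` holds at all nearby points of the section, so its tangential
derivative vanishes. -/
lemma ingoing_tangential_r (j : Fin (D - 2)) :
    pd j (R u) x * pd (Sum.inl 1) (fun q => lower S.metric n q (Sum.inl 1)) (mk u (R u x) x)
      + pd (Sum.inr j) (fun q => lower S.metric n q (Sum.inl 1)) (mk u (R u x) x) = 0 := by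
  rw [← pd_section ((contDiffOn_slice hR hq).differentiableAt (by norm_num))
    (differentiableAt_lower_r (hn.differentiable u x hq)), ← pd_const j (-1) x]
  refine pd_congr ?_
  filter_upwards [eventually_mem_W hq] with y hy
  exact ingoing_lower_r hn hy

lemma ingoing_tangential_i (i j : Fin (D - 2)) :
    pd j (R u) x * pd (Sum.inl 1) (fun q => lower S.metric n q (Sum.inr i)) (mk u (R u x) x)
      + pd (Sum.inr j) (fun q => lower S.metric n q (Sum.inr i)) (mk u (R u x) x) =
      pd j (fun y => pd i (R u) y) x := by
  rw [← pd_section ((contDiffOn_slice hR hq).differentiableAt (by norm_num))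
    (differentiableAt_lower_i hq (hn.differentiable u x hq) i)]
  refine pd_congr ?_
  filter_upwards [eventually_mem_W hq] with y hy
  exact ingoing_lower_i hn hy i

lemma expansion_ingoing (hD : 4 ≤ D) (hr : R u x ≠ 0) :
    expansion S.metric outgoing n n (mk u (R u x) x) =
      (R u x ^ 2)⁻¹ * laplacian (S.h u) (R u) x
      - 2 / R u x ^ 3 * ip (S.h u) x (gradient (S.h u) (R u) x) (gradient (S.h u) (R u) x)
      - ((D : ℝ) - 2) * deriv (fun s => Real.log (S.P s x)) u
      + ((D : ℝ) - 2) / R u x * n (mk u (R u x) x) (Sum.inl 1) := by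
  have hcard : ((D - 2 : ℕ) : ℝ) = (D : ℝ) - 2 := by
    rw [Nat.cast_sub (by omega)]; norm_num
  have hnr := ingoing_comp_r hn hq hr
  have hG := ip_gradient (f := R u) (h_det hq) (gradient (S.h u) (R u) x)
  have hlow : ∀ j, R u x * ∑ k, n (mk u (R u x) x) (Sum.inr k) * S.h u x k j =
      pd j (R u) x / R u x := by
    intro j
    rw [← ingoing_sum_h_mul hn hq j]
    simp only [mul_comm (n _ _), (h_isSymm hq).apply]
    field_simp
  have htr : ∀ j, pd (Sum.inr j) (fun q => lower S.metric n q (Sum.inl 1)) (mk u (R u x) x) =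
      -(pd j (R u) x *
        pd (Sum.inl 1) (fun q => lower S.metric n q (Sum.inl 1)) (mk u (R u x) x)) := fun j => by
    linarith [ingoing_tangential_r hR hn hq j]
  have hti : ∀ i j,
      pd (Sum.inr j) (fun q => lower S.metric n q (Sum.inr i)) (mk u (R u x) x)
        - pd j (fun y => pd i (R u) y) x = -(pd j (R u) x *
        pd (Sum.inl 1) (fun q => lower S.metric n q (Sum.inr i)) (mk u (R u x) x)) := fun i j => by
    linarith [ingoing_tangential_i hR hn hq i j]
  rw [expansion, sum_mul_projector hq hr (ingoing_comp_u hn hq), covDeriv_rr hq hr]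
  simp only [covDeriv_rj hq hr, covDeriv_jr hq hr,
    covDeriv_ij hq hr (ingoing_comp_u hn hq) (ingoing_comp_x hn hq hr), hlow, htr, hti]
  -- `A = ∂_r n_r` and `B_i = ∂_r n_i` depend on the extension of `n` off the hypersurface. As
  -- opaque symbols they cancel: `A` between the `rr` term and `h1`, because `2H + 2n^r = R⁻²
  -- |∇R|²`, and `B` between `h2` and `h3`.
  generalize pd (Sum.inl 1) (fun q => lower S.metric n q (Sum.inl 1)) (mk u (R u x) x) = A
  generalize hB : (fun i => pd (Sum.inl 1) (fun q => lower S.metric n q (Sum.inr i))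
    (mk u (R u x) x)) = B
  simp only [funext_iff] at hB
  simp only [hB]
  set c := R u x * n (mk u (R u x) x) (Sum.inl 1)
    - R u x ^ 2 * deriv (fun s => Real.log (S.P s x)) u with hc
  have h1 : ∑ j, n (mk u (R u x) x) (Sum.inr j) * (-(pd j (R u) x * A) - pd j (R u) x / R u x) =
      -(A + 1 / R u x) * ((R u x ^ 2)⁻¹ *
        ip (S.h u) x (gradient (S.h u) (R u) x) (gradient (S.h u) (R u) x)) := by
    rw [hG, Finset.mul_sum, Finset.mul_sum]
    exact Finset.sum_congr rfl fun j _ => by rw [ingoing_comp_x hn hq hr]; ring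
  have h2 : ∑ j, n (mk u (R u x) x) (Sum.inr j) * (B j - pd j (R u) x / R u x) =
      (R u x ^ 2)⁻¹ * ∑ j, gradient (S.h u) (R u) x j * B j - 1 / R u x * ((R u x ^ 2)⁻¹ *
        ip (S.h u) x (gradient (S.h u) (R u) x) (gradient (S.h u) (R u) x)) := by
    rw [hG, Finset.mul_sum, Finset.mul_sum, Finset.mul_sum, ← Finset.sum_sub_distrib]
    exact Finset.sum_congr rfl fun j _ => by rw [ingoing_comp_x hn hq hr]; ring
  have h3 : ∑ i, ∑ j, (S.h u x)⁻¹ i j * (-(pd j (R u) x * B i)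
      + covDeriv (S.h u) (fun y c => pd c (R u) y) i j x + c * S.h u x i j) =
      -(∑ j, gradient (S.h u) (R u) x j * B j) + laplacian (S.h u) (R u) x
        + c * ((D : ℝ) - 2) := by
    have h4 := sum_inv_mul_self (h_isSymm hq) (h_det hq)
    rw [Fintype.card_fin, hcard] at h4
    rw [← h4]
    simp only [laplacian, gradient, Finset.mul_sum, Finset.sum_mul, ← Finset.sum_neg_distrib,
      ← Finset.sum_add_distrib]
    exact Finset.sum_congr rfl fun i _ => Finset.sum_congr rfl fun j _ => by ring
  rw [h1, h2, h3, hc, hnr]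
  field_simp
  ring

include hRpos

lemma expansion_eq_zero_iff (hD : 4 ≤ D) :
    expansion S.metric outgoing n n (mk u (R u x) x) = 0 ↔ penroseTod S R u x = 0 := by
  have hpos := hRpos u x hq
  have hr : R u x ≠ 0 := hpos.ne'
  have hD' : (4 : ℝ) ≤ D := by exact_mod_cast hD
  have h1 : (D : ℝ) - 1 ≠ 0 := by linarith
  have h2 : (D : ℝ) - 2 ≠ 0 := by linarith
  have h3 : (D : ℝ) - 3 ≠ 0 := by linarith
  have hs := contDiffOn_slice hR hq
  -- The factor is fixed by comparing the `ΔR` terms: `R⁻² ΔR` in the expansion against `-2 (D-3) ΔR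
  -- / R` from `Δ ln R`.
  have key : penroseTod S R u x = -(2 * R u x * ((D : ℝ) - 3)) *
      expansion S.metric outgoing n n (mk u (R u x) x) := by
    rw [expansion_ingoing hR hn hq hD hr, ingoing_comp_r hn hq hr, penroseTod,
      laplacian_log (h_det hq) hs hr, gradient_log _ (hs.differentiableAt (by norm_num)) hr,
      ip_smul_smul, Data.H]
    have hp : R u x ^ (D - 3) ≠ 0 := pow_ne_zero _ hr
    -- The exponent is a truncated natural subtraction, and only the nonvanishing of this power
    -- matters for the algebra.
    generalize R u x ^ (D - 3) = Q at hp ⊢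
    field_simp
    ring
  rw [key, mul_eq_zero, or_iff_right]
  exact neg_ne_zero.2 (mul_ne_zero (mul_ne_zero two_ne_zero hr) h3)

end Ingoing

end Hypersurface

end RobinsonTrautman

/-- Generalized Penrose–Tod equation: the explicit field `ingoing S R` is an ingoing null congruence
of the hypersurface `r = R(u, x)`; for every ingoing null congruence `n` of the hypersurface, the
expansion of `n` vanishes at a point of the hypersurface exactly when the generalized Penrose–Tod
equation holds there; and the expansion of the outgoing congruence is `(D - 2) / r`. -/
theorem mainTheorem1 (D : ℕ) (hD : 4 ≤ D) (S : RobinsonTrautman.Data D)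
    (R : ℝ → (Fin (D - 2) → ℝ) → ℝ)
    (hR : ContDiffOn ℝ 2 (fun q : ℝ × (Fin (D - 2) → ℝ) => R q.1 q.2) S.W)
    (hRpos : ∀ u x, (u, x) ∈ S.W → 0 < R u x) :
    RobinsonTrautman.IsIngoing S R (RobinsonTrautman.ingoing S R) ∧
    (∀ n : (RobinsonTrautman.Idx D → ℝ) → RobinsonTrautman.Idx D → ℝ,
      RobinsonTrautman.IsIngoing S R n →
      ∀ u x, (u, x) ∈ S.W →
        (RobinsonTrautman.expansion S.metric RobinsonTrautman.outgoing n n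
            (RobinsonTrautman.mk u (R u x) x) = 0 ↔
          RobinsonTrautman.penroseTod S R u x = 0)) ∧
    (∀ n : (RobinsonTrautman.Idx D → ℝ) → RobinsonTrautman.Idx D → ℝ,
      ∀ u r x, (u, x) ∈ S.W → 0 < r →
        RobinsonTrautman.ip S.metric (RobinsonTrautman.mk u r x)
          (n (RobinsonTrautman.mk u r x)) (n (RobinsonTrautman.mk u r x)) = 0 →
        RobinsonTrautman.ip S.metric (RobinsonTrautman.mk u r x)
          (RobinsonTrautman.outgoing (RobinsonTrautman.mk u r x))
          (n (RobinsonTrautman.mk u r x)) = -1 →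
        RobinsonTrautman.expansion S.metric RobinsonTrautman.outgoing n
            RobinsonTrautman.outgoing (RobinsonTrautman.mk u r x) = ((D : ℝ) - 2) / r) := by
  refine ⟨RobinsonTrautman.isIngoing_ingoing hR hRpos,
    fun n hn u x hq => RobinsonTrautman.expansion_eq_zero_iff hR hRpos hn hq hD, fun n u r x hq hr _ hn => ?_⟩
  rw [RobinsonTrautman.ip_outgoing, neg_inj] at hn
  exact RobinsonTrautman.expansion_outgoing hD hq hr.ne' hn
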